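/- \textbf{Definitions.} Let $\mathfrak A$ be a nonzero unital C*-algebra, $\mathfrak{sa}(\mathfrak A)$ its self-adjoint part and $\mathscr S(\mathfrak A)$ its state space with the weak* topology. Let $\mathsf L$ be a seminorm defined on a norm-dense real subspace $\mathrm{dom}(\mathsf L)$ of $\mathfrak{sa}(\mathfrak A)$, extended by $\mathsf L(a)=\infty$ for $a\notin \mathrm{dom}(\mathsf L)$, with $\{a:\mathsf L(a)=0\}=\mathbb R 1_{\mathfrak A}$. Its Monge--Kantorovich metric is $$\mathsf{mk}_{\mathsf L}(\varphi,\psi)=\sup\{|\varphi(a)-\psi(a)| : a\in\mathfrak{sa}(\mathfrak A),\ \mathsf L(a)\le 1\},\qquad \varphi,\psi\in\mathscr S(\mathfrak A).$$ The pair $(\mathfrak A,\mathsf L)$ is a \emph{Leibniz quantum compact metric space} if $\mathsf{mk}_{\mathsf L}$ is a (finite) metric inducing the weak* topology of $\mathscr S(\mathfrak A)$, $\mathsf L$ is lower semicontinuous for the norm, and for all $a,b\in\mathrm{dom}(\mathsf L)$ both $\mathsf L\big(\tfrac12(ab+ba)\big)$ and $\mathsf L\big(\tfrac1{2i}(ab-ba)\big)$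 are at most $\|a\|_{\mathfrak A}\mathsf L(b)+\|b\|_{\mathfrak A}\mathsf L(a)$. A \emph{tunnel} $\tau=(\mathfrak D,\mathsf L_{\mathfrak D},\pi_{\mathfrak A},\pi_{\mathfrak B})$ from $(\mathfrak A,\mathsf L_{\mathfrak A})$ to $(\mathfrak B,\mathsf L_{\mathfrak B})$ consists of a Leibniz quantum compact metric space $(\mathfrak D,\mathsf L_{\mathfrak D})$ and unital surjective *-morphisms $\pi_{\mathfrak A}:\mathfrak D\to\mathfrak A$, $\pi_{\mathfrak B}:\mathfrak D\to\mathfrak B$ such that $\mathsf L_{\mathfrak A}(a)=\inf\{\mathsf L_{\mathfrak D}(d): d\in\mathfrak{sa}(\mathfrak D),\ \pi_{\mathfrak A}(d)=a\}$ for all $a\in\mathfrak{sa}(\mathfrak A)$, and likewise for $\mathfrak B$. Put $X=\{\varphi\circ\pi_{\mathfrak A}:\varphi\in\mathscr S(\mathfrak A)\}$ and $Y=\{\psi\circ\pi_{\mathfrak B}:\psi\in\mathscr S(\mathfrak B)\}$. The \emph{length} of $\tau$ is the larger of the Hausdorff distances, for $\mathsf{mk}_{\mathsf L_{\mathfrak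 D}}$, between $X$ and $Y$ (the reach of $\tau$) and between $\mathscr S(\mathfrak D)$ and the weak* closed convex hull of $X\cup Y$ (the depth of $\tau$). A \emph{journey} from $(\mathfrak A,\mathsf L_{\mathfrak A})$ to $(\mathfrak B,\mathsf L_{\mathfrak B})$ is a finite nonempty sequence of tunnels $\tau_j$ from $(\mathfrak A_j,\mathsf L_j)$ to $(\mathfrak A_{j+1},\mathsf L_{j+1})$, $j=1,\dots,n$, between arbitrary Leibniz quantum compact metric spaces, with $(\mathfrak A_1,\mathsf L_1)=(\mathfrak A,\mathsf L_{\mathfrak A})$ and $(\mathfrak A_{n+1},\mathsf L_{n+1})=(\mathfrak B,\mathsf L_{\mathfrak B})$; its length is the sum of the lengths of the $\tau_j$. The \emph{dual Gromov--Hausdorff propinquity} $\mathsf\Lambda^\ast((\mathfrak A,\mathsf L_{\mathfrak A}),(\mathfrak B,\mathsf L_{\mathfrak B}))$ is the infimum of the lengths of all journeys from $(\mathfrak A,\mathsf L_{\mathfrak A})$ to $(\mathfrak B,\mathsf L_{\mathfrak B})$. \textbf{Corollary.} For any two Leibniz quantum compact metric spaces $(\mathfrak A,\mathsf L_{\mathfrak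 A})$ and $(\mathfrak B,\mathsf L_{\mathfrak B})$, $$\mathsf\Lambda^\ast((\mathfrak A,\mathsf L_{\mathfrak A}),(\mathfrak B,\mathsf L_{\mathfrak B}))\le\max\left\{\mathrm{diam}(\mathscr S(\mathfrak A),\mathsf{mk}_{\mathsf L_{\mathfrak A}}),\ \mathrm{diam}(\mathscr S(\mathfrak B),\mathsf{mk}_{\mathsf L_{\mathfrak B}})\right\}.$$ -/

import Mathlib

universe u

namespace QuantumMetric

open scoped ENNReal

section States

open scoped ComplexOrder

/-- The state space of a unital C*-algebra: the positive linear functionals of value `1` at the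
unit, inside the dual endowed with the weak* topology. As a type it carries the weak* topology. -/
def stateSpace (A : Type u) [CStarAlgebra A] : Set (WeakDual ℂ A) :=
  {φ | (∀ a : A, 0 ≤ φ (star a * a)) ∧ φ 1 = 1}

end States

section JordanLie

variable {A : Type u} [CStarAlgebra A]

/-- The Jordan product `(ab + ba) / 2` of self-adjoint elements. -/
noncomputable def jordan (a b : selfAdjoint A) : selfAdjoint A :=
  ⟨(1 / 2 : ℂ) • ((a : A) * b + b * a), by
    rw [selfAdjoint.mem_iff, star_smul, star_add, star_mul, star_mul, a.2.star_eq, b.2.star_eq,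
      add_comm]
    simp⟩

/-- The Lie product `(ab - ba) / 2i` of self-adjoint elements. -/
noncomputable def lie (a b : selfAdjoint A) : selfAdjoint A :=
  ⟨(1 / (2 * Complex.I) : ℂ) • ((a : A) * b - b * a), by
    rw [selfAdjoint.mem_iff, star_smul, star_sub, star_mul, star_mul, a.2.star_eq, b.2.star_eq,
      ← neg_sub ((a : A) * b), smul_neg, ← neg_smul]
    congr 1
    simp⟩

end JordanLie

section LipNorms

variable {A : Type u} [CStarAlgebra A]

/-- `(A, L)` is a Lipschitz pair. The seminorm `L`, defined on a dense subspace of the self-adjoint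
part, is represented by its extension by `∞` outside its domain `{a | L a < ∞}`. -/
structure IsLipschitzPair (L : selfAdjoint A → ℝ≥0∞) : Prop where
  add_le : ∀ a b, L (a + b) ≤ L a + L b
  smul_eq : ∀ (t : ℝ) a, L (t • a) = ENNReal.ofReal |t| * L a
  dense_dom : Dense {a | L a < ∞}
  eq_zero_iff : ∀ a, L a = 0 ↔ ∃ t : ℝ, a = t • (1 : selfAdjoint A)

/-- The Monge-Kantorovich (extended) distance between two states. -/
noncomputable def mkEDist (L : selfAdjoint A → ℝ≥0∞) (φ ψ : stateSpace A) : ℝ≥0∞ :=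
  ⨆ (a : selfAdjoint A) (_ : L a ≤ 1), ENNReal.ofReal ‖φ.1 (a : A) - ψ.1 (a : A)‖

/-- The Monge-Kantorovich distance as an extended (pseudo)metric structure on the state space.
It is not an instance, since the state space already carries its weak* topology. -/
@[reducible]
noncomputable def mkSpace (L : selfAdjoint A → ℝ≥0∞) : PseudoEMetricSpace (stateSpace A) where
  edist := mkEDist L
  edist_self φ := by simp [mkEDist]
  edist_comm φ ψ := by simp only [mkEDist, norm_sub_rev]
  edist_triangle φ ψ χ := by
    refine iSup₂_le fun a ha => ?_
    calc ENNReal.ofReal ‖φ.1 (a : A) - χ.1 (a : A)‖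
        ≤ ENNReal.ofReal ‖φ.1 (a : A) - ψ.1 (a : A)‖
            + ENNReal.ofReal ‖ψ.1 (a : A) - χ.1 (a : A)‖ := by
          rw [← ENNReal.ofReal_add (norm_nonneg _) (norm_nonneg _)]
          exact ENNReal.ofReal_le_ofReal (norm_sub_le_norm_sub_add_norm_sub _ _ _)
      _ ≤ _ := add_le_add
          (le_iSup₂ (f := fun (a : selfAdjoint A) (_ : L a ≤ 1) =>
            ENNReal.ofReal ‖φ.1 (a : A) - ψ.1 (a : A)‖) a ha)
          (le_iSup₂ (f := fun (a : selfAdjoint A) (_ : L a ≤ 1) =>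
            ENNReal.ofReal ‖ψ.1 (a : A) - χ.1 (a : A)‖) a ha)

/-- `(A, L)` is a quantum compact metric space: a Lipschitz pair whose Monge-Kantorovich metric is
finite and induces the weak* topology on the state space. -/
structure IsQuantumCompactMetric (L : selfAdjoint A → ℝ≥0∞) : Prop
    extends IsLipschitzPair L where
  mkEDist_ne_top : ∀ φ ψ, mkEDist L φ ψ ≠ ∞
  metrizes : (mkSpace L).toUniformSpace.toTopologicalSpace
    = (instTopologicalSpaceSubtype : TopologicalSpace (stateSpace A))

/-- `L` is a Leibniz seminorm: on its domain it satisfies the two Leibniz inequalities (which force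
the domain to be closed under the Jordan and the Lie product, as the right-hand sides are finite). -/
structure IsLeibniz (L : selfAdjoint A → ℝ≥0∞) : Prop where
  jordan_le : ∀ a b, L a < ∞ → L b < ∞ →
    L (jordan a b) ≤ ENNReal.ofReal ‖(a : A)‖ * L b + ENNReal.ofReal ‖(b : A)‖ * L a
  lie_le : ∀ a b, L a < ∞ → L b < ∞ →
    L (lie a b) ≤ ENNReal.ofReal ‖(a : A)‖ * L b + ENNReal.ofReal ‖(b : A)‖ * L a

end LipNorms

/-- A Leibniz quantum compact metric space: a (nonzero) unital C*-algebra with a lower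
semicontinuous Leibniz Lip-norm. -/
structure LeibnizQCMS : Type (u + 1) where
  carrier : Type u
  [cstar : CStarAlgebra carrier]
  [nontrivial : Nontrivial carrier]
  lip : selfAdjoint carrier → ℝ≥0∞
  isQuantumCompactMetric : IsQuantumCompactMetric lip
  isLeibniz : IsLeibniz lip
  lowerSemicontinuous : LowerSemicontinuous lip

instance : CoeSort LeibnizQCMS.{u} (Type u) := ⟨LeibnizQCMS.carrier⟩

instance (A : LeibnizQCMS.{u}) : CStarAlgebra A := A.cstar

instance (A : LeibnizQCMS.{u}) : Nontrivial A := A.nontrivial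

/-- The diameter of the state space for the Monge-Kantorovich metric. -/
noncomputable def LeibnizQCMS.stateDiam (A : LeibnizQCMS.{u}) : ℝ≥0∞ :=
  @Metric.ediam (stateSpace A) (mkSpace A.lip) Set.univ

/-- The Hausdorff distance between sets of states for the Monge-Kantorovich metric. -/
noncomputable def LeibnizQCMS.hausdorff (A : LeibnizQCMS.{u}) (S T : Set (stateSpace A)) : ℝ≥0∞ :=
  @Metric.hausdorffEDist (stateSpace A) (mkSpace A.lip) S T

section DualMap

variable {D A : Type u} [CStarAlgebra D] [CStarAlgebra A]

/-- A unital *-morphism as a continuous linear map. -/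
noncomputable def toCLM (π : D →⋆ₐ[ℂ] A) : D →L[ℂ] A :=
  LinearMap.mkContinuous π.toAlgHom.toLinearMap 1 fun d => by
    rw [one_mul]; exact NonUnitalStarAlgHom.norm_apply_le π d

/-- The dual map `φ ↦ φ ∘ π` from states of `A` to states of `D` of a unital *-morphism
`π : D → A`. -/
noncomputable def dualMap (π : D →⋆ₐ[ℂ] A) (φ : stateSpace A) : stateSpace D :=
  ⟨StrongDual.toWeakDual
      ((WeakDual.toStrongDual φ.1).comp (toCLM π)), by
    refine ⟨fun d => ?_, ?_⟩
    · have h := φ.2.1 (π d)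
      rw [← map_star, ← map_mul] at h
      exact h
    · have h := φ.2.2
      rw [← map_one π] at h
      exact h⟩

end DualMap

/-- A tunnel from `A` to `B`: a Leibniz quantum compact metric space with two unital
*-epimorphisms, onto `A` and `B`, whose quotient seminorms are the given Lip-norms. -/
structure Tunnel (A B : LeibnizQCMS.{u}) : Type (u + 1) where
  space : LeibnizQCMS.{u}
  left : space →⋆ₐ[ℂ] A
  right : space →⋆ₐ[ℂ] B
  left_surjective : Function.Surjective left
  right_surjective : Function.Surjective right
  left_quotient : ∀ a : selfAdjoint A,
    A.lip a = ⨅ (d : selfAdjoint space) (_ : left (d : space) = (a : A)), space.lip d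
  right_quotient : ∀ b : selfAdjoint B,
    B.lip b = ⨅ (d : selfAdjoint space) (_ : right (d : space) = (b : B)), space.lip d

namespace Tunnel

variable {A B : LeibnizQCMS.{u}} (τ : Tunnel A B)

/-- The reach: the Hausdorff distance between the copies of the two state spaces. -/
noncomputable def reach : ℝ≥0∞ :=
  τ.space.hausdorff (Set.range (dualMap τ.left)) (Set.range (dualMap τ.right))

/-- The weak* closed convex hull, in the dual of the algebra of the tunnel, of the copies of the
two state spaces. It consists of states, so nothing is lost in the restriction to states. -/
noncomputable def hull : Set (stateSpace τ.space) :=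
  {χ | (χ : WeakDual ℂ τ.space) ∈ closedConvexHull ℝ
    (Subtype.val '' (Set.range (dualMap τ.left) ∪ Set.range (dualMap τ.right)))}

/-- The depth: the Hausdorff distance between the full state space and the hull. -/
noncomputable def depth : ℝ≥0∞ := τ.space.hausdorff Set.univ τ.hull

/-- The length of a tunnel. -/
noncomputable def length : ℝ≥0∞ := max τ.reach τ.depth

end Tunnel

/-- A journey from `A` to `B`: a finite (nonempty) chain of tunnels, each of which starts at the
space at which the previous one ends, through arbitrary Leibniz quantum compact metric spaces. -/
inductive Journey : LeibnizQCMS.{u} → LeibnizQCMS.{u} → Type (u + 1)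
  | single {A B : LeibnizQCMS.{u}} (τ : Tunnel A B) : Journey A B
  | cons {A B C : LeibnizQCMS.{u}} (τ : Tunnel A B) (Υ : Journey B C) : Journey A C

/-- The length of a journey: the sum of the lengths of its tunnels. -/
noncomputable def Journey.length {A B : LeibnizQCMS.{u}} : Journey A B → ℝ≥0∞
  | .single τ => τ.length
  | .cons τ Υ => τ.length + Υ.length

/-- The dual Gromov-Hausdorff propinquity: the infimum of the lengths of all journeys. -/
noncomputable def dualPropinquity (A B : LeibnizQCMS.{u}) : ℝ≥0∞ :=
  ⨅ Υ : Journey A B, Υ.length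

end QuantumMetric

/-! A single tunnel through A × B suffices. Fix a real r above both diameters, a state φ₀ of A and a
state ψ₀ of B, and take the seminorm max(L_A(a), L_B(b), N(a, b)/r), where N measures how far (a, b)
is from a common scalar. Since states are not multiplicative, ‖a - ψ₀(b)1‖ has no evident Leibniz
inequality. Instead N is the larger of the norms of aT - Tb and bS - Sa, with T x = ψ₀(x)1 and S x =
φ₀(x)1. These commutators are derivations, hence Leibniz, and evaluation at 1 gives ‖a - ψ₀(b)1‖ ≤ N
and ‖b - φ₀(a)1‖ ≤ N.

Quotients: the norm of a self-adjoint element is attained at a state, so ‖a - φ₀(a)1‖ ≤ r L_A(a). As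
N(a, φ₀(a)1) ≤ ‖a - φ₀(a)1‖, the lift (a, φ₀(a)1) costs no more than L_A(a); B is symmetric.

Length: on the unit Lip ball (a, b) lies within r of φ₀(a)(1, 1), so every state of A × B is within
r of φ₀ ∘ π_A; likewise ψ₀ ∘ π_B is within r of every φ ∘ π_A. This bounds reach and depth by r.

Metrization: states of A × B are mixtures of states of A and B, so the weak* and the
Monge-Kantorovich topologies are Hausdorff quotients of the same compact space S(A) × S(B) × [0,1]
by the same map. -/

namespace QuantumMetric

open scoped ENNReal ComplexOrder Topology unitInterval

/-! ### Positivity and norm of functionals -/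

section PositiveFunctionals

variable {A : Type u} [CStarAlgebra A]

attribute [local instance] CStarAlgebra.spectralOrder CStarAlgebra.spectralOrderedRing

/-- A continuous functional which is nonnegative on squares, as a positive linear map. -/
noncomputable def toPositiveLinearMap (f : A →L[ℂ] ℂ) (hf : ∀ a, 0 ≤ f (star a * a)) :
    A →ₚ[ℂ] ℂ :=
  PositiveLinearMap.mk₀ f.toLinearMap fun a ha => by
    obtain ⟨b, rfl⟩ := CStarAlgebra.nonneg_iff_eq_star_mul_self.mp ha
    exact hf b

/-- Cauchy-Schwarz for the GNS form, applied to 1 and a, combined with f(a*a) ≤ ‖f 1‖ ‖a‖². -/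
theorem norm_le_of_positive (f : A →L[ℂ] ℂ) (hf : ∀ a, 0 ≤ f (star a * a)) (a : A) :
    ‖f a‖ ≤ ‖f 1‖ * ‖a‖ := by
  let g := toPositiveLinearMap f hf
  have hg : ∀ x, g x = f x := fun _ => rfl
  have h1 := norm_inner_le_norm (𝕜 := ℂ) (g.toPreGNS 1) (g.toPreGNS a)
  rw [PositiveLinearMap.preGNS_inner_def, g.ofPreGNS_toPreGNS, g.ofPreGNS_toPreGNS, star_one,
    one_mul, hg] at h1
  have h2 : ∀ x : A, ‖g.toPreGNS x‖ ^ 2 ≤ ‖f 1‖ * ‖x‖ ^ 2 := by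
    intro x
    have h3 := g.norm_apply_le_of_nonneg (star x * x) (star_mul_self_nonneg x)
    have h4 := g.preGNS_norm_sq (g.toPreGNS x)
    rw [g.ofPreGNS_toPreGNS] at h4
    rw [← h4, CStarRing.norm_star_mul_self, hg] at h3
    simpa [sq] using h3
  have h5 : ‖g.toPreGNS 1‖ ^ 2 = ‖f 1‖ := by
    have h4 := congrArg norm (g.preGNS_norm_sq (g.toPreGNS 1))
    rw [g.ofPreGNS_toPreGNS, star_one, one_mul, hg] at h4
    simpa using h4
  refine le_of_sq_le_sq ?_ (by positivity)
  calc ‖f a‖ ^ 2 ≤ (‖g.toPreGNS 1‖ * ‖g.toPreGNS a‖) ^ 2 := by gcongr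
    _ = ‖f 1‖ * ‖g.toPreGNS a‖ ^ 2 := by rw [mul_pow, h5]
    _ ≤ ‖f 1‖ * (‖f 1‖ * ‖a‖ ^ 2) := by gcongr; exact h2 a
    _ = _ := by ring

theorem map_star_of_positive (f : A →L[ℂ] ℂ) (hf : ∀ a, 0 ≤ f (star a * a)) (a : A) :
    f (star a) = star (f a) :=
  map_star (toPositiveLinearMap f hf) a

theorem norm_add_I_smul_sq_le (h : selfAdjoint A) (t : ℝ) :
    ‖(h : A) + (t * Complex.I) • (1 : A)‖ ^ 2 ≤ ‖(h : A)‖ ^ 2 + t ^ 2 := by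
  rw [sq, ← CStarRing.norm_star_mul_self]
  have : star ((h : A) + (t * Complex.I) • (1 : A)) * ((h : A) + (t * Complex.I) • (1 : A))
      = (h : A) * h + ((t ^ 2 : ℝ) : ℂ) • (1 : A) := by
    rw [star_add, h.2.star_eq, star_smul, star_one]
    simp only [add_mul, mul_add, smul_mul_assoc, mul_smul_comm, one_mul, mul_one, smul_add,
      smul_smul, Complex.star_def, map_mul, Complex.conj_ofReal, Complex.conj_I]
    have e : (t : ℂ) * Complex.I * (t * -Complex.I) = ((t ^ 2 : ℝ) : ℂ) := by
      push_cast
      linear_combination -(t : ℂ) ^ 2 * Complex.I_sq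
    rw [e, mul_neg, neg_smul]
    abel
  rw [this]
  refine (norm_add_le _ _).trans (add_le_add ?_ ?_)
  · rw [sq]; exact norm_mul_le _ _
  · rw [norm_smul, Complex.norm_real, Real.norm_of_nonneg (sq_nonneg t)]
    rcases subsingleton_or_nontrivial A with hA | hA
    · rw [Subsingleton.elim (1 : A) 0, norm_zero, mul_zero]; positivity
    · rw [norm_one, mul_one]

/-- For h = a*a, contractivity on h + it bounds 2t Im f(h) independently of t, so f(h) is real.
Since 0 ≤ ‖h‖ - h ≤ ‖h‖, contractivity gives ‖h‖ - f(h) ≤ ‖h‖. -/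
theorem positive_of_norm_le_one (f : A →L[ℂ] ℂ) (hf : ∀ a, ‖f a‖ ≤ ‖a‖) (h1 : f 1 = 1) (a : A) :
    0 ≤ f (star a * a) := by
  set h : selfAdjoint A := ⟨star a * a, .star_mul_self a⟩ with hh
  change 0 ≤ f (h : A)
  have him : (f (h : A)).im = 0 := by
    have key : ∀ t : ℝ, 2 * t * (f (h : A)).im ≤ ‖(h : A)‖ ^ 2 := by
      intro t
      have h2 := (pow_le_pow_left₀ (norm_nonneg _)
        (hf ((h : A) + (t * Complex.I) • (1 : A))) 2).trans (norm_add_I_smul_sq_le h t)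
      rw [map_add, map_smul, h1, Complex.sq_norm, Complex.normSq_apply] at h2
      simp at h2
      nlinarith [sq_nonneg (f (h : A)).re, sq_nonneg (f (h : A)).im]
    by_contra hne
    -- For this t the left side of `key` equals ‖h‖² + 1.
    have := key ((‖(h : A)‖ ^ 2 + 1) / (2 * (f (h : A)).im))
    rw [show 2 * ((‖(h : A)‖ ^ 2 + 1) / (2 * (f (h : A)).im)) * (f (h : A)).im
      = ‖(h : A)‖ ^ 2 + 1 by field_simp] at this
    linarith
  have hnn : (0 : A) ≤ h := star_mul_self_nonneg a
  have hle : (h : A) ≤ algebraMap ℝ A ‖(h : A)‖ := IsSelfAdjoint.le_algebraMap_norm_self h.2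
  have h3 : ‖algebraMap ℝ A ‖(h : A)‖ - h‖ ≤ ‖(h : A)‖ := by
    refine (CStarAlgebra.norm_le_norm_of_nonneg_of_le (sub_nonneg.mpr hle)
      (sub_le_self _ hnn)).trans ?_
    rw [norm_algebraMap]
    rcases subsingleton_or_nontrivial A with hA | hA
    · rw [Subsingleton.elim (1 : A) 0, norm_zero, mul_zero]; positivity
    · simp
  have h4 := (hf _).trans h3
  rw [map_sub, Algebra.algebraMap_eq_smul_one, ← Complex.coe_smul, map_smul, h1] at h4
  have h5 := (Complex.abs_re_le_norm _).trans h4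
  simp at h5
  rw [Complex.nonneg_iff]
  refine ⟨?_, him.symm⟩
  linarith [(abs_le.mp h5).2]

end PositiveFunctionals

/-! ### Weak* compactness and norm-attaining states -/

section StateSpace

variable {A : Type u} [CStarAlgebra A]

theorem stateSpace_norm_le (φ : stateSpace A) (a : A) : ‖φ.1 a‖ ≤ ‖a‖ := by
  have h := norm_le_of_positive (WeakDual.toStrongDual φ.1) φ.2.1 a
  change ‖φ.1 a‖ ≤ ‖φ.1 1‖ * ‖a‖ at h
  rwa [φ.2.2, norm_one, one_mul] at h

theorem stateSpace_im_eq_zero (φ : stateSpace A) (a : selfAdjoint A) : (φ.1 (a : A)).im = 0 := by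
  have h := map_star_of_positive (WeakDual.toStrongDual φ.1) φ.2.1 (a : A)
  rw [a.2.star_eq] at h
  exact Complex.conj_eq_iff_im.mp h.symm

theorem stateSpace_coe_re (φ : stateSpace A) (a : selfAdjoint A) :
    ((φ.1 (a : A)).re : ℂ) = φ.1 (a : A) :=
  Complex.ext rfl (stateSpace_im_eq_zero φ a).symm

instance : CompactSpace (stateSpace A) := by
  rw [← isCompact_iff_compactSpace]
  refine WeakDual.isCompact_of_bounded_of_closed ?_ ?_
  · refine (WeakDual.isBounded_closedBall (0 : StrongDual ℂ A) 1).subset fun φ hφ => ?_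
    rw [Set.mem_preimage, mem_closedBall_zero_iff]
    exact ContinuousLinearMap.opNorm_le_bound _ zero_le_one fun a => by
      rw [one_mul]; exact stateSpace_norm_le ⟨φ, hφ⟩ a
  · have : stateSpace A = (⋂ a : A, {φ | 0 ≤ φ (star a * a)}) ∩ {φ | φ 1 = 1} := by
      ext φ; simp [stateSpace]
    rw [this]
    refine IsClosed.inter (isClosed_iInter fun a => ?_) ?_
    · exact isClosed_le continuous_const (WeakDual.eval_continuous _)
    · exact isClosed_eq (WeakDual.eval_continuous _) continuous_const

/-- A Hahn-Banach functional g norming a + ‖a‖1 has Re g(a) + ‖a‖ Re g(1) = 2‖a‖. Contractivity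
forces equality in both terms, so g(1) = 1 and g is a state. -/
theorem exists_state_of_norm_add_eq [Nontrivial A] (a : selfAdjoint A) (ha : (a : A) ≠ 0)
    (h : ‖(a : A) + (‖(a : A)‖ : ℂ) • (1 : A)‖ = 2 * ‖(a : A)‖) :
    ∃ φ : stateSpace A, φ.1 (a : A) = ‖(a : A)‖ := by
  obtain ⟨g, hg, hga⟩ := exists_dual_vector'' ℂ ((a : A) + (‖(a : A)‖ : ℂ) • (1 : A))
  have hb : ∀ x, ‖g x‖ ≤ ‖x‖ := fun x => (g.le_opNorm x).trans (by
    have := norm_nonneg x; nlinarith)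
  have hpos : 0 < ‖(a : A)‖ := norm_pos_iff.mpr ha
  rw [h, map_add, map_smul] at hga
  have hre := congrArg Complex.re hga
  simp at hre
  have ha1 := hb a
  have ha2 := hb 1
  rw [norm_one] at ha2
  have hr1 := (Complex.re_le_norm _).trans ha1
  have hr2 := (Complex.re_le_norm _).trans ha2
  have e2 : (g 1).re = 1 := by nlinarith
  have e1 : (g (a : A)).re = ‖(a : A)‖ := by nlinarith
  have eq_of : ∀ (z : ℂ) (r : ℝ), ‖z‖ ≤ r → z.re = r → z = r := by
    intro z r hz hzr
    have hr : 0 ≤ r := (norm_nonneg z).trans hz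
    have := pow_le_pow_left₀ (norm_nonneg _) hz 2
    rw [Complex.sq_norm, Complex.normSq_apply, hzr] at this
    refine Complex.ext hzr ?_
    simp
    nlinarith [sq_nonneg z.im]
  have g1 : g 1 = 1 := by simpa using eq_of _ _ ha2 e2
  exact ⟨⟨StrongDual.toWeakDual g, positive_of_norm_le_one g hb g1, g1⟩, eq_of _ _ ha1 e1⟩

theorem norm_add_norm_smul_one_of_mem_spectrum (a : selfAdjoint A) [Nontrivial A]
    (h : (‖(a : A)‖ : ℂ) ∈ spectrum ℂ (a : A)) :
    ‖(a : A) + (‖(a : A)‖ : ℂ) • (1 : A)‖ = 2 * ‖(a : A)‖ := by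
  refine le_antisymm ((norm_add_le _ _).trans ?_) ?_
  · rw [norm_smul, norm_one]; simp; linarith
  · have : (‖(a : A)‖ : ℂ) + ‖(a : A)‖ ∈
        spectrum ℂ (algebraMap ℂ A (‖(a : A)‖ : ℂ) + (a : A)) :=
      spectrum.add_mem_add_iff.mpr h
    have h2 := spectrum.norm_le_norm_of_mem this
    rw [Algebra.algebraMap_eq_smul_one, ← two_mul, add_comm] at h2
    simpa using h2

/-- The spectrum is real and its radius is the norm, so ‖a‖ or -‖a‖ is a spectral value; in the
second case a is replaced by -a. -/
theorem exists_state_norm_eq [Nontrivial A] (a : selfAdjoint A) :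
    ∃ φ : stateSpace A, ‖φ.1 (a : A)‖ = ‖(a : A)‖ := by
  have key : ∀ b : selfAdjoint A, (b : A) ≠ 0 → ∃ φ : stateSpace A, ‖φ.1 (b : A)‖ = ‖(b : A)‖ := by
    intro b hb
    obtain ⟨z, hz, hzr⟩ := spectrum.exists_nnnorm_eq_spectralRadius (b : A)
    rw [b.2.spectralRadius_eq_nnnorm] at hzr
    have hzn : ‖z‖ = ‖(b : A)‖ := congrArg NNReal.toReal (ENNReal.coe_injective hzr)
    have hzre : z = z.re := b.2.mem_spectrum_eq_re hz
    rcases le_total 0 z.re with h0 | h0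
    · have : z = (‖(b : A)‖ : ℂ) := by
        rw [← hzn, hzre, Complex.norm_real, Real.norm_of_nonneg h0]
      obtain ⟨φ, hφ⟩ := exists_state_of_norm_add_eq b hb
        (norm_add_norm_smul_one_of_mem_spectrum b (this ▸ hz))
      exact ⟨φ, by rw [hφ]; simp⟩
    · have : -z = (‖((-b : selfAdjoint A) : A)‖ : ℂ) := by
        rw [AddSubgroup.coe_neg, norm_neg, ← hzn, hzre, Complex.norm_real, Real.norm_of_nonpos h0]
        simp
      have hz' : -z ∈ spectrum ℂ ((-b : selfAdjoint A) : A) := by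
        rw [AddSubgroup.coe_neg, ← spectrum.neg_eq]; simpa using hz
      obtain ⟨φ, hφ⟩ := exists_state_of_norm_add_eq (-b) (by simpa using hb)
        (norm_add_norm_smul_one_of_mem_spectrum (-b) (this ▸ hz'))
      refine ⟨φ, ?_⟩
      have := congrArg norm hφ
      simpa using this
  by_cases ha : (a : A) = 0
  · obtain ⟨φ, -⟩ := key 1 (by simp)
    exact ⟨φ, by simp [ha]⟩
  · exact key a ha

instance [Nontrivial A] : Nonempty (stateSpace A) :=
  ⟨(exists_state_norm_eq (1 : selfAdjoint A)).choose⟩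

end StateSpace

/-! ### Lipschitz estimates for the Monge-Kantorovich distance -/

section MongeKantorovich

variable {A : Type u} [CStarAlgebra A] {L : selfAdjoint A → ℝ≥0∞}

theorem ofReal_norm_sub_le_mkEDist (φ ψ : stateSpace A) (a : selfAdjoint A) (ha : L a ≤ 1) :
    ENNReal.ofReal ‖φ.1 (a : A) - ψ.1 (a : A)‖ ≤ mkEDist L φ ψ :=
  le_iSup₂ (f := fun (a : selfAdjoint A) (_ : L a ≤ 1) =>
    ENNReal.ofReal ‖φ.1 (a : A) - ψ.1 (a : A)‖) a ha

theorem stateSpace_real_smul (φ : stateSpace A) (t : ℝ) (a : A) :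
    φ.1 (t • a) = t * φ.1 a := by
  rw [← Complex.coe_smul, map_smul, smul_eq_mul]

theorem stateSpace_apply_smul_one (φ : stateSpace A) (t : ℝ) : φ.1 (t • (1 : A)) = t := by
  rw [stateSpace_real_smul, φ.2.2, mul_one]

theorem IsLipschitzPair.ofReal_norm_sub_le (hL : IsLipschitzPair L) (φ ψ : stateSpace A)
    (a : selfAdjoint A) (ha : L a < ∞) :
    ENNReal.ofReal ‖φ.1 (a : A) - ψ.1 (a : A)‖ ≤ L a * mkEDist L φ ψ := by
  -- Elements of zero seminorm cannot be rescaled to the unit Lip sphere, but they are scalars, on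
  -- which all states agree.
  by_cases h0 : L a = 0
  · obtain ⟨t, rfl⟩ := (hL.eq_zero_iff a).mp h0
    have : ((t • (1 : selfAdjoint A) : selfAdjoint A) : A) = t • (1 : A) := rfl
    rw [this, stateSpace_apply_smul_one, stateSpace_apply_smul_one]
    simp
  · have hc : 0 < (L a).toReal := ENNReal.toReal_pos h0 ha.ne
    have h1 : L ((L a).toReal⁻¹ • a) = 1 := by
      rw [hL.smul_eq, abs_of_pos (inv_pos.mpr hc), ENNReal.ofReal_inv_of_pos hc,
        ENNReal.ofReal_toReal ha.ne, ENNReal.inv_mul_cancel h0 ha.ne]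
    have h2 := ofReal_norm_sub_le_mkEDist φ ψ _ h1.le
    rw [selfAdjoint.val_smul, stateSpace_real_smul, stateSpace_real_smul, ← mul_sub, norm_mul,
      Complex.norm_real, Real.norm_of_nonneg (inv_nonneg.mpr hc.le)] at h2
    calc ENNReal.ofReal ‖φ.1 (a : A) - ψ.1 (a : A)‖
        = ENNReal.ofReal ((L a).toReal *
            ((L a).toReal⁻¹ * ‖φ.1 (a : A) - ψ.1 (a : A)‖)) := by
          rw [mul_inv_cancel_left₀ hc.ne']
      _ = L a * ENNReal.ofReal ((L a).toReal⁻¹ * ‖φ.1 (a : A) - ψ.1 (a : A)‖) := by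
          rw [ENNReal.ofReal_mul hc.le, ENNReal.ofReal_toReal ha.ne]
      _ ≤ _ := by gcongr

/-- States at Monge-Kantorovich distance zero agree. -/
theorem IsLipschitzPair.eq_of_mkEDist_eq_zero (hL : IsLipschitzPair L) {φ ψ : stateSpace A}
    (h : mkEDist L φ ψ = 0) : φ = ψ := by
  have hsa : ∀ a : selfAdjoint A, φ.1 (a : A) = ψ.1 (a : A) := by
    have hc : ∀ χ : stateSpace A, Continuous fun a : selfAdjoint A => χ.1 (a : A) := fun χ =>
      χ.1.cont.comp continuous_subtype_val
    refine congrFun (Continuous.ext_on hL.dense_dom (hc φ) (hc ψ) fun a ha => ?_)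
    have h1 := hL.ofReal_norm_sub_le φ ψ a ha
    rw [h, mul_zero, nonpos_iff_eq_zero, ENNReal.ofReal_eq_zero] at h1
    exact sub_eq_zero.mp (norm_le_zero_iff.mp h1)
  refine Subtype.ext (ContinuousLinearMap.ext fun a => ?_)
  rw [← realPart_add_I_smul_imaginaryPart a]
  change φ.1 _ = ψ.1 _
  rw [map_add, map_add, map_smul, map_smul, hsa, hsa]

/-- A self-adjoint element is, up to a scalar, bounded in norm by the oscillation of the states. -/
theorem IsLipschitzPair.ofReal_norm_sub_smul_one_le [Nontrivial A] (hL : IsLipschitzPair L)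
    {M : ℝ≥0∞} (hM : ∀ φ ψ, mkEDist L φ ψ ≤ M) (φ : stateSpace A) (a : selfAdjoint A)
    (ha : L a < ∞) :
    ENNReal.ofReal ‖(a : A) - (φ.1 (a : A)).re • (1 : A)‖ ≤ L a * M := by
  obtain ⟨ψ, hψ⟩ := exists_state_norm_eq (a - (φ.1 (a : A)).re • (1 : selfAdjoint A))
  have : ((a - (φ.1 (a : A)).re • (1 : selfAdjoint A) : selfAdjoint A) : A)
      = (a : A) - (φ.1 (a : A)).re • (1 : A) := rfl
  rw [this, map_sub, stateSpace_apply_smul_one, stateSpace_coe_re] at hψ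
  rw [← hψ]
  exact (hL.ofReal_norm_sub_le ψ φ a ha).trans (by gcongr; exact hM _ _)

end MongeKantorovich

theorem mkEDist_le_stateDiam (A : LeibnizQCMS.{u}) (φ ψ : stateSpace A) :
    mkEDist A.lip φ ψ ≤ A.stateDiam := by
  let := mkSpace A.lip
  exact Metric.edist_le_ediam_of_mem (Set.mem_univ φ) (Set.mem_univ ψ)

theorem LeibnizQCMS.tendsto_mkEDist (A : LeibnizQCMS.{u}) (φ : stateSpace A) :
    Filter.Tendsto (fun ψ => mkEDist A.lip ψ φ) (𝓝 φ) (𝓝 0) := by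
  have h := A.isQuantumCompactMetric.metrizes
  rw [← h]
  let := mkSpace A.lip
  exact tendsto_iff_edist_tendsto_0.mp Filter.tendsto_id

/-! ### Stability of the Leibniz property -/

section Leibniz

variable {D A : Type u} [CStarAlgebra D] [CStarAlgebra A]

theorem IsLeibniz.max {L L' : selfAdjoint D → ℝ≥0∞} (h : IsLeibniz L) (h' : IsLeibniz L') :
    IsLeibniz fun d => max (L d) (L' d) where
  jordan_le a b ha hb := by
    rw [max_lt_iff] at ha hb
    refine max_le ((h.jordan_le a b ha.1 hb.1).trans ?_) ((h'.jordan_le a b ha.2 hb.2).trans ?_)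
    · gcongr <;> exact le_max_left _ _
    · gcongr <;> exact le_max_right _ _
  lie_le a b ha hb := by
    rw [max_lt_iff] at ha hb
    refine max_le ((h.lie_le a b ha.1 hb.1).trans ?_) ((h'.lie_le a b ha.2 hb.2).trans ?_)
    · gcongr <;> exact le_max_left _ _
    · gcongr <;> exact le_max_right _ _

/-- The restriction of a unital *-morphism to self-adjoint elements. -/
def selfAdjointMap (π : D →⋆ₐ[ℂ] A) (d : selfAdjoint D) : selfAdjoint A :=
  ⟨π d, d.2.map π⟩

theorem IsLeibniz.comap {L : selfAdjoint A → ℝ≥0∞} (h : IsLeibniz L) (π : D →⋆ₐ[ℂ] A) :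
    IsLeibniz fun d => L (selfAdjointMap π d) where
  jordan_le a b ha hb := by
    have e : selfAdjointMap π (jordan a b) = jordan (selfAdjointMap π a) (selfAdjointMap π b) :=
      Subtype.ext (by simp [selfAdjointMap, jordan])
    rw [e]
    refine (h.jordan_le _ _ ha hb).trans ?_
    gcongr <;> exact NonUnitalStarAlgHom.norm_apply_le π _
  lie_le a b ha hb := by
    have e : selfAdjointMap π (lie a b) = lie (selfAdjointMap π a) (selfAdjointMap π b) :=
      Subtype.ext (by simp [selfAdjointMap, lie])
    rw [e]
    refine (h.lie_le _ _ ha hb).trans ?_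
    gcongr <;> exact NonUnitalStarAlgHom.norm_apply_le π _

/-- The products ab and ba each contribute the full Leibniz bound; the factor 1/2 in the Jordan and
Lie products compensates. -/
theorem isLeibniz_ofReal_norm {X : Type*} [SeminormedAddCommGroup X] [NormedSpace ℂ X]
    (δ : D →L[ℂ] X) (hδ : ∀ a b, ‖δ (a * b)‖ ≤ ‖a‖ * ‖δ b‖ + ‖b‖ * ‖δ a‖) {c : ℝ} (hc : 0 ≤ c) :
    IsLeibniz fun d : selfAdjoint D => ENNReal.ofReal (c * ‖δ (d : D)‖) := by
  have key : ∀ a b : selfAdjoint D, ∀ z : ℂ, ‖z‖ = 1 / 2 → ∀ y : D,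
      ‖δ y‖ ≤ ‖δ ((a : D) * b)‖ + ‖δ ((b : D) * a)‖ →
      ENNReal.ofReal (c * ‖δ (z • y)‖) ≤
        ENNReal.ofReal ‖(a : D)‖ * ENNReal.ofReal (c * ‖δ (b : D)‖)
          + ENNReal.ofReal ‖(b : D)‖ * ENNReal.ofReal (c * ‖δ (a : D)‖) := by
    intro a b z hz y hy
    rw [← ENNReal.ofReal_mul (norm_nonneg _), ← ENNReal.ofReal_mul (norm_nonneg _),
      ← ENNReal.ofReal_add (by positivity) (by positivity)]
    refine ENNReal.ofReal_le_ofReal ?_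
    rw [map_smul, norm_smul, hz]
    calc c * (1 / 2 * ‖δ y‖)
        ≤ c * (‖(a : D)‖ * ‖δ (b : D)‖ + ‖(b : D)‖ * ‖δ (a : D)‖) := by
          refine mul_le_mul_of_nonneg_left ?_ hc
          linarith [hδ a b, hδ b a]
      _ = _ := by ring
  constructor
  · intro a b _ _
    exact key a b _ (by simp) _ (by rw [map_add]; exact norm_add_le _ _)
  · intro a b _ _
    exact key a b _ (by simp) _ (by rw [map_sub]; exact norm_sub_le _ _)

end Leibniz

/-! ### Commutators with rank-one operators -/

section StateDifference

variable {A B : Type u} [CStarAlgebra A] [CStarAlgebra B]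

open ContinuousLinearMap in
/-- The commutator `(a, b) ↦ aT - Tb` for the operator `T x = ψ x • 1` from `B` to `A`. -/
noncomputable def stateCommutator (ψ : B →L[ℂ] ℂ) : A × B →L[ℂ] (B →L[ℂ] A) :=
  (smulRightL ℂ B A ψ) ∘L fst ℂ A B
    - (((smulRightL ℂ B A).flip 1) ∘L (compL ℂ B B ℂ ψ) ∘L (mul ℂ B)) ∘L snd ℂ A B

theorem stateCommutator_apply (ψ : B →L[ℂ] ℂ) (d : A × B) (x : B) :
    stateCommutator ψ d x = ψ x • d.1 - ψ (d.2 * x) • (1 : A) := rfl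

/-- With d = (a, b) and e = (a', b'), the derivation identity is aa'T - Tbb' = a(a'T - Tb') + (aT -
Tb)b'. -/
theorem stateCommutator_mul (ψ : B →L[ℂ] ℂ) (d e : A × B) :
    ‖stateCommutator ψ (d * e)‖
      ≤ ‖d‖ * ‖stateCommutator ψ e‖ + ‖e‖ * ‖stateCommutator ψ d‖ := by
  have h : stateCommutator ψ (d * e) = (ContinuousLinearMap.mul ℂ A d.1) ∘L stateCommutator ψ e
      + stateCommutator ψ d ∘L ContinuousLinearMap.mul ℂ B e.2 := by
    ext x
    simp [stateCommutator_apply, mul_sub, mul_assoc]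
  have h1 : ‖ContinuousLinearMap.mul ℂ A d.1‖ ≤ ‖d‖ :=
    (ContinuousLinearMap.opNorm_mul_apply_le ℂ A d.1).trans (norm_fst_le d)
  have h2 : ‖ContinuousLinearMap.mul ℂ B e.2‖ ≤ ‖e‖ :=
    (ContinuousLinearMap.opNorm_mul_apply_le ℂ B e.2).trans (norm_snd_le e)
  rw [h, mul_comm ‖e‖]
  refine (norm_add_le _ _).trans (add_le_add ?_ ?_)
  · exact (ContinuousLinearMap.opNorm_comp_le _ _).trans (by gcongr)
  · exact (ContinuousLinearMap.opNorm_comp_le _ _).trans (by gcongr)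

theorem norm_sub_le_stateCommutator (ψ : stateSpace B) (a : A) (b : B) :
    ‖a - ψ.1 b • (1 : A)‖ ≤ ‖stateCommutator (WeakDual.toStrongDual ψ.1) (a, b)‖ := by
  have h := (stateCommutator (WeakDual.toStrongDual ψ.1) (a, b)).le_opNorm 1
  rw [stateCommutator_apply, mul_one] at h
  change ‖ψ.1 1 • a - ψ.1 b • (1 : A)‖ ≤ _ at h
  rw [ψ.2.2, one_smul] at h
  refine h.trans (mul_le_of_le_one_right (norm_nonneg _) ?_)
  have := stateSpace_norm_le ψ 1
  rcases subsingleton_or_nontrivial B with hB | hB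
  · rw [Subsingleton.elim (1 : B) 0, norm_zero]; exact zero_le_one
  · exact norm_one.le

/-- For b = z1 the commutator is x ↦ ψ(x)(a - z1). This makes lifts by scalars cheap. -/
theorem stateCommutator_smul_one_right_le (ψ : stateSpace B) (a : A) (z : ℂ) :
    ‖stateCommutator (WeakDual.toStrongDual ψ.1) (a, z • (1 : B))‖ ≤ ‖a - z • (1 : A)‖ := by
  refine ContinuousLinearMap.opNorm_le_bound _ (norm_nonneg _) fun x => ?_
  rw [stateCommutator_apply]
  change ‖ψ.1 x • a - ψ.1 (z • (1 : B) * x) • (1 : A)‖ ≤ _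
  rw [smul_mul_assoc, one_mul, map_smul, smul_eq_mul, mul_comm z, mul_smul, ← smul_sub, norm_smul,
    mul_comm]
  gcongr
  exact stateSpace_norm_le ψ x

theorem stateCommutator_smul_one_left_le [Nontrivial A] (ψ : stateSpace B) (z : ℂ) (b : B) :
    ‖stateCommutator (WeakDual.toStrongDual ψ.1) (z • (1 : A), b)‖ ≤ ‖b - z • (1 : B)‖ := by
  refine ContinuousLinearMap.opNorm_le_bound _ (norm_nonneg _) fun x => ?_
  rw [stateCommutator_apply]
  change ‖ψ.1 x • z • (1 : A) - ψ.1 (b * x) • (1 : A)‖ ≤ _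
  rw [smul_smul, ← sub_smul, norm_smul, norm_one, mul_one, norm_sub_rev]
  have : ψ.1 (b * x) - ψ.1 x * z = ψ.1 ((b - z • (1 : B)) * x) := by
    rw [sub_mul, map_sub, smul_mul_assoc, one_mul, map_smul, smul_eq_mul, mul_comm z]
  rw [this]
  exact (stateSpace_norm_le ψ _).trans (norm_mul_le _ _)

end StateDifference

/-- A continuous surjection from a compact space onto a Hausdorff space is a quotient map, so q
determines the topology. -/
theorem topology_eq_of_continuous_surjective {K S : Type*} [TopologicalSpace K] [CompactSpace K]
    (t₁ t₂ : TopologicalSpace S) (h₁ : @T2Space S t₁) (h₂ : @T2Space S t₂) {q : K → S}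
    (hq : Function.Surjective q) (c₁ : @Continuous K S _ t₁ q) (c₂ : @Continuous K S _ t₂ q) :
    t₁ = t₂ := by
  have key : ∀ t : TopologicalSpace S, @T2Space S t → @Continuous K S _ t q →
      t = TopologicalSpace.coinduced q inferInstance := fun _ _ hc =>
    (Topology.IsQuotientMap.of_surjective_continuous hq hc).eq_coinduced
  exact (key t₁ h₁ c₁).trans (key t₂ h₂ c₂).symm

/-! ### States of a product as mixtures -/

section Mixtures

variable {A B : Type u} [CStarAlgebra A] [CStarAlgebra B]

/-- A positive functional is a multiple of a state. -/
theorem exists_state_smul_eq [Nontrivial A] (f : A →L[ℂ] ℂ) (hf : ∀ a, 0 ≤ f (star a * a)) :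
    ∃ φ : stateSpace A, ∀ a, f a = f 1 * φ.1 a := by
  have h1 : 0 ≤ f 1 := by simpa using hf 1
  by_cases h0 : f 1 = 0
  · refine ⟨Classical.arbitrary _, fun a => ?_⟩
    have := norm_le_of_positive f hf a
    rw [h0, norm_zero, zero_mul] at this
    rw [h0, zero_mul, norm_le_zero_iff.mp this]
  · refine ⟨⟨StrongDual.toWeakDual ((f 1)⁻¹ • f), fun a => ?_, ?_⟩, fun a => ?_⟩
    · exact mul_nonneg (inv_nonneg.mpr h1) (hf a)
    · exact inv_mul_cancel₀ h0
    · exact (mul_inv_cancel_left₀ h0 _).symm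

/-- The convex combination of a state of `A` and a state of `B`, as a state of `A × B`. -/
noncomputable def mixState (k : stateSpace A × stateSpace B × I) : stateSpace (A × B) :=
  ⟨((k.2.2 : ℝ) : ℂ) • (dualMap (StarAlgHom.fst ℂ A B) k.1).1
      + ((1 - (k.2.2 : ℝ) : ℝ) : ℂ) • (dualMap (StarAlgHom.snd ℂ A B) k.2.1).1, by
    refine ⟨fun a => ?_, ?_⟩
    · refine add_nonneg (mul_nonneg ?_ ((dualMap (StarAlgHom.fst ℂ A B) k.1).2.1 a))
        (mul_nonneg ?_ ((dualMap (StarAlgHom.snd ℂ A B) k.2.1).2.1 a))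
      · exact Complex.zero_le_real.mpr k.2.2.2.1
      · exact Complex.zero_le_real.mpr (sub_nonneg.mpr k.2.2.2.2)
    · change _ * (dualMap (StarAlgHom.fst ℂ A B) k.1).1 1
        + _ * (dualMap (StarAlgHom.snd ℂ A B) k.2.1).1 1 = 1
      rw [(dualMap (StarAlgHom.fst ℂ A B) k.1).2.2, (dualMap (StarAlgHom.snd ℂ A B) k.2.1).2.2]
      simp⟩

theorem mixState_apply (k : stateSpace A × stateSpace B × I) (d : A × B) :
    (mixState k).1 d
      = ((k.2.2 : ℝ) : ℂ) * k.1.1 d.1 + ((1 - (k.2.2 : ℝ) : ℝ) : ℂ) * k.2.1.1 d.2 := rfl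

theorem continuous_mixState : Continuous (mixState (A := A) (B := B)) := by
  refine Continuous.subtype_mk (WeakDual.continuous_of_continuous_eval fun d => ?_) _
  change Continuous fun k : stateSpace A × stateSpace B × I =>
    ((k.2.2 : ℝ) : ℂ) * k.1.1 d.1 + ((1 - (k.2.2 : ℝ) : ℝ) : ℂ) * k.2.1.1 d.2
  have hA : Continuous fun k : stateSpace A × stateSpace B × I => k.1.1 d.1 :=
    (WeakDual.eval_continuous d.1).comp (continuous_subtype_val.comp continuous_fst)
  have hB : Continuous fun k : stateSpace A × stateSpace B × I => k.2.1.1 d.2 :=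
    (WeakDual.eval_continuous d.2).comp
      (continuous_subtype_val.comp (continuous_fst.comp continuous_snd))
  have hs : Continuous fun k : stateSpace A × stateSpace B × I => (k.2.2 : ℝ) := by fun_prop
  exact ((Complex.continuous_ofReal.comp hs).mul hA).add
    ((Complex.continuous_ofReal.comp (continuous_const.sub hs)).mul hB)

/-- The restrictions of χ to the two summands are positive, hence multiples of states; their values
at the units are the weights, which sum to χ(1) = 1. -/
theorem mixState_surjective [Nontrivial A] [Nontrivial B] :
    Function.Surjective (mixState (A := A) (B := B)) := by
  intro χ
  let f : A →L[ℂ] ℂ := (WeakDual.toStrongDual χ.1) ∘L ContinuousLinearMap.inl ℂ A B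
  let g : B →L[ℂ] ℂ := (WeakDual.toStrongDual χ.1) ∘L ContinuousLinearMap.inr ℂ A B
  have hfa : ∀ a, f a = χ.1 (a, 0) := fun _ => rfl
  have hgb : ∀ b, g b = χ.1 (0, b) := fun _ => rfl
  have hfp : ∀ a, 0 ≤ f (star a * a) := fun a => by
    have e : star ((a, 0) : A × B) * (a, 0) = (star a * a, 0) := by ext <;> simp
    rw [hfa, ← e]
    exact χ.2.1 (a, 0)
  have hgp : ∀ b, 0 ≤ g (star b * b) := fun b => by
    have e : star ((0, b) : A × B) * (0, b) = (0, star b * b) := by ext <;> simp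
    rw [hgb, ← e]
    exact χ.2.1 (0, b)
  have hadd : ∀ d, χ.1 d = f d.1 + g d.2 := fun d => by
    rw [hfa, hgb, ← map_add]; simp
  obtain ⟨φ, hφ⟩ := exists_state_smul_eq f hfp
  obtain ⟨ψ, hψ⟩ := exists_state_smul_eq g hgp
  have hsum : f 1 + g 1 = 1 := by rw [← χ.2.2]; exact (hadd 1).symm
  have hf1 : 0 ≤ f 1 := by simpa using hfp 1
  have hg1 : 0 ≤ g 1 := by simpa using hgp 1
  have hfr : (((f 1).re : ℝ) : ℂ) = f 1 :=
    Complex.ext rfl (Complex.nonneg_iff.mp hf1).2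
  have hre := congrArg Complex.re hsum
  rw [Complex.add_re, Complex.one_re] at hre
  refine ⟨(φ, ψ, ⟨(f 1).re, (Complex.nonneg_iff.mp hf1).1, ?_⟩), ?_⟩
  · linarith [(Complex.nonneg_iff.mp hg1).1]
  · refine Subtype.ext (ContinuousLinearMap.ext fun d => ?_)
    change (mixState _).1 d = χ.1 d
    rw [mixState_apply, hadd, hφ d.1, hψ d.2]
    simp only [Complex.ofReal_sub, Complex.ofReal_one, hfr, ← eq_sub_iff_add_eq'.mpr hsum]

end Mixtures

/-! ### The coupling Lip-norm on A × B -/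

section ProductSeminorm

variable (A B : LeibnizQCMS.{u}) (φ₀ : stateSpace A) (ψ₀ : stateSpace B) (r : ℝ)

/-- The two commutators defined by a state of `A` and a state of `B`. -/
noncomputable def pairCommutator : A × B →L[ℂ] (B →L[ℂ] A) × (A →L[ℂ] B) :=
  (stateCommutator (WeakDual.toStrongDual ψ₀.1)).prod
    ((stateCommutator (WeakDual.toStrongDual φ₀.1)) ∘L
      (ContinuousLinearEquiv.prodComm ℂ A B : A × B →L[ℂ] B × A))

theorem pairCommutator_mul (d e : A × B) :
    ‖pairCommutator A B φ₀ ψ₀ (d * e)‖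
      ≤ ‖d‖ * ‖pairCommutator A B φ₀ ψ₀ e‖ + ‖e‖ * ‖pairCommutator A B φ₀ ψ₀ d‖ := by
  have hswap : ∀ x : A × B, ‖x.swap‖ = ‖x‖ := fun x => max_comm _ _
  refine max_le ?_ ?_
  · refine (stateCommutator_mul _ d e).trans ?_
    gcongr
    · exact norm_fst_le (pairCommutator A B φ₀ ψ₀ e)
    · exact norm_fst_le (pairCommutator A B φ₀ ψ₀ d)
  · refine (stateCommutator_mul _ d.swap e.swap).trans ?_
    rw [hswap, hswap]
    gcongr
    · exact norm_snd_le (pairCommutator A B φ₀ ψ₀ e)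
    · exact norm_snd_le (pairCommutator A B φ₀ ψ₀ d)

theorem norm_sub_le_pairCommutator_left (a : A) (b : B) :
    ‖a - ψ₀.1 b • (1 : A)‖ ≤ ‖pairCommutator A B φ₀ ψ₀ (a, b)‖ :=
  (norm_sub_le_stateCommutator ψ₀ a b).trans (norm_fst_le (pairCommutator A B φ₀ ψ₀ (a, b)))

theorem norm_sub_le_pairCommutator_right (a : A) (b : B) :
    ‖b - φ₀.1 a • (1 : B)‖ ≤ ‖pairCommutator A B φ₀ ψ₀ (a, b)‖ :=
  (norm_sub_le_stateCommutator φ₀ b a).trans (norm_snd_le (pairCommutator A B φ₀ ψ₀ (a, b)))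

theorem pairCommutator_right_scalar_le (a : A) (z : ℂ) :
    ‖pairCommutator A B φ₀ ψ₀ (a, z • (1 : B))‖ ≤ ‖a - z • (1 : A)‖ :=
  max_le (stateCommutator_smul_one_right_le ψ₀ a z) (stateCommutator_smul_one_left_le φ₀ z a)

theorem pairCommutator_left_scalar_le (z : ℂ) (b : B) :
    ‖pairCommutator A B φ₀ ψ₀ (z • (1 : A), b)‖ ≤ ‖b - z • (1 : B)‖ :=
  max_le (stateCommutator_smul_one_left_le ψ₀ z b) (stateCommutator_smul_one_right_le φ₀ b z)

/-- The Lip-norm on `A × B` with commutator scale `r`. -/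
noncomputable def prodLip (d : selfAdjoint (A × B)) : ℝ≥0∞ :=
  max (max (A.lip (selfAdjointMap (StarAlgHom.fst ℂ A B) d))
    (B.lip (selfAdjointMap (StarAlgHom.snd ℂ A B) d)))
    (ENNReal.ofReal (r⁻¹ * ‖pairCommutator A B φ₀ ψ₀ (d : A × B)‖))

theorem lip_fst_le (d : selfAdjoint (A × B)) :
    A.lip (selfAdjointMap (StarAlgHom.fst ℂ A B) d) ≤ prodLip A B φ₀ ψ₀ r d :=
  (le_max_left _ _).trans (le_max_left _ _)

theorem lip_snd_le (d : selfAdjoint (A × B)) :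
    B.lip (selfAdjointMap (StarAlgHom.snd ℂ A B) d) ≤ prodLip A B φ₀ ψ₀ r d :=
  (le_max_right _ _).trans (le_max_left _ _)

variable {A B} in
/-- A pair of self-adjoint elements, as a self-adjoint element of the product. -/
def selfAdjointPair (a : selfAdjoint A) (b : selfAdjoint B) : selfAdjoint (A × B) :=
  ⟨((a : A), (b : B)), Prod.ext a.2 b.2⟩

theorem prodLip_isLeibniz (hr : 0 < r) : IsLeibniz (prodLip A B φ₀ ψ₀ r) :=
  ((A.isLeibniz.comap (StarAlgHom.fst ℂ A B)).max (B.isLeibniz.comap (StarAlgHom.snd ℂ A B))).max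
    (isLeibniz_ofReal_norm (pairCommutator A B φ₀ ψ₀) (pairCommutator_mul A B φ₀ ψ₀)
      (inv_nonneg.mpr hr.le))

theorem continuous_selfAdjointMap {D E : Type u} [CStarAlgebra D] [CStarAlgebra E]
    (π : D →⋆ₐ[ℂ] E) : Continuous (selfAdjointMap π) :=
  Continuous.subtype_mk ((toCLM π).continuous.comp continuous_subtype_val) _

theorem prodLip_lowerSemicontinuous : LowerSemicontinuous (prodLip A B φ₀ ψ₀ r) := by
  refine LowerSemicontinuous.sup (LowerSemicontinuous.sup ?_ ?_) ?_
  · exact A.lowerSemicontinuous.comp (continuous_selfAdjointMap _)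
  · exact B.lowerSemicontinuous.comp (continuous_selfAdjointMap _)
  · refine Continuous.lowerSemicontinuous (ENNReal.continuous_ofReal.comp
      (continuous_const.mul (continuous_norm.comp
        ((pairCommutator A B φ₀ ψ₀).continuous.comp continuous_subtype_val))))

theorem prodLip_isLipschitzPair (hr : 0 < r) : IsLipschitzPair (prodLip A B φ₀ ψ₀ r) where
  add_le d e := by
    refine max_le (max_le ?_ ?_) ?_
    · have h : selfAdjointMap (StarAlgHom.fst ℂ A B) (d + e)
          = selfAdjointMap (StarAlgHom.fst ℂ A B) d + selfAdjointMap (StarAlgHom.fst ℂ A B) e := rfl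
      rw [h]
      exact (A.isQuantumCompactMetric.add_le _ _).trans
        (add_le_add (lip_fst_le ..) (lip_fst_le ..))
    · have h : selfAdjointMap (StarAlgHom.snd ℂ A B) (d + e)
          = selfAdjointMap (StarAlgHom.snd ℂ A B) d + selfAdjointMap (StarAlgHom.snd ℂ A B) e := rfl
      rw [h]
      exact (B.isQuantumCompactMetric.add_le _ _).trans
        (add_le_add (lip_snd_le ..) (lip_snd_le ..))
    · refine le_trans ?_ (add_le_add (le_max_right _ _) (le_max_right _ _))
      rw [← ENNReal.ofReal_add (by positivity) (by positivity), ← mul_add, AddSubgroup.coe_add,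
        map_add]
      gcongr
      exact norm_add_le _ _
  smul_eq t d := by
    have h1 : selfAdjointMap (StarAlgHom.fst ℂ A B) (t • d)
        = t • selfAdjointMap (StarAlgHom.fst ℂ A B) d := rfl
    have h2 : selfAdjointMap (StarAlgHom.snd ℂ A B) (t • d)
        = t • selfAdjointMap (StarAlgHom.snd ℂ A B) d := rfl
    rw [prodLip, prodLip, h1, h2, A.isQuantumCompactMetric.smul_eq,
      B.isQuantumCompactMetric.smul_eq, mul_max, mul_max, selfAdjoint.val_smul, ← Complex.coe_smul,
      map_smul, norm_smul, Complex.norm_real, Real.norm_eq_abs, mul_left_comm,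
      ENNReal.ofReal_mul (abs_nonneg t)]
  dense_dom := by
    refine Metric.dense_iff.mpr fun d ε hε => ?_
    obtain ⟨a, ha, haL⟩ := Metric.dense_iff.mp A.isQuantumCompactMetric.dense_dom
      (selfAdjointMap (StarAlgHom.fst ℂ A B) d) ε hε
    obtain ⟨b, hb, hbL⟩ := Metric.dense_iff.mp B.isQuantumCompactMetric.dense_dom
      (selfAdjointMap (StarAlgHom.snd ℂ A B) d) ε hε
    exact ⟨selfAdjointPair a b, Metric.mem_ball.mpr (max_lt ha hb), max_lt (max_lt haL hbL) ENNReal.ofReal_lt_top⟩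
  eq_zero_iff d := by
    constructor
    · intro h
      obtain ⟨s, hs⟩ := (A.isQuantumCompactMetric.eq_zero_iff _).mp
        (nonpos_iff_eq_zero.mp ((lip_fst_le A B φ₀ ψ₀ r d).trans h.le))
      have hs' : (d : A × B).1 = s • (1 : A) := congrArg Subtype.val hs
      have hN : ENNReal.ofReal (r⁻¹ * ‖pairCommutator A B φ₀ ψ₀ (d : A × B)‖) = 0 :=
        nonpos_iff_eq_zero.mp ((le_max_right _ _).trans h.le)
      rw [ENNReal.ofReal_eq_zero] at hN
      have hN' : ‖pairCommutator A B φ₀ ψ₀ (d : A × B)‖ ≤ 0 :=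
        nonpos_of_mul_nonpos_right hN (inv_pos.mpr hr)
      -- The vanishing commutator forces the B-coordinate to be φ₀(s1) = s, the same scalar as in A.
      have h2 := (norm_sub_le_pairCommutator_right A B φ₀ ψ₀ (d : A × B).1 (d : A × B).2).trans hN'
      rw [hs', stateSpace_apply_smul_one, Complex.coe_smul, norm_le_zero_iff, sub_eq_zero] at h2
      exact ⟨s, Subtype.ext (Prod.ext hs' h2)⟩
    · rintro ⟨t, rfl⟩
      have h1 : A.lip (selfAdjointMap (StarAlgHom.fst ℂ A B) (t • 1)) = 0 :=
        (A.isQuantumCompactMetric.eq_zero_iff _).mpr ⟨t, rfl⟩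
      have h2 : B.lip (selfAdjointMap (StarAlgHom.snd ℂ A B) (t • 1)) = 0 :=
        (B.isQuantumCompactMetric.eq_zero_iff _).mpr ⟨t, rfl⟩
      have h3 : ‖pairCommutator A B φ₀ ψ₀ ((t • 1 : selfAdjoint (A × B)) : A × B)‖ = 0 := by
        have := pairCommutator_right_scalar_le A B φ₀ ψ₀ ((t : ℂ) • (1 : A)) t
        rw [sub_self, norm_zero] at this
        exact le_antisymm this (norm_nonneg _)
      rw [prodLip, h1, h2, h3]
      simp

variable {A B r}

theorem prodLip_le_one_iff (hr : 0 < r) (d : selfAdjoint (A × B)) :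
    prodLip A B φ₀ ψ₀ r d ≤ 1 ↔ A.lip (selfAdjointMap (StarAlgHom.fst ℂ A B) d) ≤ 1
      ∧ B.lip (selfAdjointMap (StarAlgHom.snd ℂ A B) d) ≤ 1
      ∧ ‖pairCommutator A B φ₀ ψ₀ (d : A × B)‖ ≤ r := by
  rw [prodLip, max_le_iff, max_le_iff, and_assoc, ENNReal.ofReal_le_one, inv_mul_le_iff₀ hr,
    mul_one]

theorem norm_sub_state_le {M : ℝ} (hM : 0 ≤ M) (hA : ∀ φ ψ, mkEDist A.lip φ ψ ≤ ENNReal.ofReal M)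
    (φ : stateSpace A) (a : selfAdjoint A) (ha : A.lip a ≤ 1) :
    ‖(a : A) - (φ.1 (a : A)).re • (1 : A)‖ ≤ M := by
  have h := A.isQuantumCompactMetric.ofReal_norm_sub_smul_one_le hA φ a
    (ha.trans_lt ENNReal.one_lt_top)
  exact (ENNReal.ofReal_le_ofReal_iff hM).mp
    (h.trans ((mul_le_mul_left ha _).trans (one_mul _).le))

/-- On the Lip ball, elements are uniformly close to the scalar given by the base state of `A`. -/
theorem norm_sub_scalar_le (hr : 0 < r) (hA : ∀ φ ψ, mkEDist A.lip φ ψ ≤ ENNReal.ofReal r)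
    (d : selfAdjoint (A × B)) (hd : prodLip A B φ₀ ψ₀ r d ≤ 1) :
    ‖(d : A × B) - φ₀.1 (d : A × B).1 • (1 : A × B)‖ ≤ r := by
  obtain ⟨h1, -, h3⟩ := (prodLip_le_one_iff φ₀ ψ₀ hr d).mp hd
  refine max_le ?_ ((norm_sub_le_pairCommutator_right A B φ₀ ψ₀ _ _).trans h3)
  have h := norm_sub_state_le hr.le hA φ₀ _ h1
  rw [← Complex.coe_smul, stateSpace_coe_re] at h
  exact h

theorem norm_state_sub_le (hr : 0 < r) (hA : ∀ φ ψ, mkEDist A.lip φ ψ ≤ ENNReal.ofReal r)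
    (d : selfAdjoint (A × B)) (hd : prodLip A B φ₀ ψ₀ r d ≤ 1) (χ : stateSpace (A × B)) :
    ‖χ.1 (d : A × B) - φ₀.1 (d : A × B).1‖ ≤ r := by
  have h := (stateSpace_norm_le χ _).trans (norm_sub_scalar_le φ₀ ψ₀ hr hA d hd)
  rwa [map_sub, map_smul, χ.2.2, smul_eq_mul, mul_one] at h

theorem mkEDist_base_le (hr : 0 < r) (hA : ∀ φ ψ, mkEDist A.lip φ ψ ≤ ENNReal.ofReal r)
    (χ : stateSpace (A × B)) :
    mkEDist (prodLip A B φ₀ ψ₀ r) χ (dualMap (StarAlgHom.fst ℂ A B) φ₀) ≤ ENNReal.ofReal r :=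
  iSup₂_le fun d hd => ENNReal.ofReal_le_ofReal (norm_state_sub_le φ₀ ψ₀ hr hA d hd χ)

theorem mkEDist_fst_snd_le (hr : 0 < r) (φ : stateSpace A) :
    mkEDist (prodLip A B φ₀ ψ₀ r) (dualMap (StarAlgHom.fst ℂ A B) φ)
      (dualMap (StarAlgHom.snd ℂ A B) ψ₀) ≤ ENNReal.ofReal r := by
  refine iSup₂_le fun d hd => ENNReal.ofReal_le_ofReal ?_
  obtain ⟨-, -, h3⟩ := (prodLip_le_one_iff φ₀ ψ₀ hr d).mp hd
  have h := (stateSpace_norm_le φ _).trans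
    ((norm_sub_le_pairCommutator_left A B φ₀ ψ₀ (d : A × B).1 (d : A × B).2).trans h3)
  rwa [map_sub, map_smul, φ.2.2, smul_eq_mul, mul_one] at h

theorem mkEDist_mixState_le (hr : 0 < r) (hA : ∀ φ ψ, mkEDist A.lip φ ψ ≤ ENNReal.ofReal r)
    (k l : stateSpace A × stateSpace B × I) :
    mkEDist (prodLip A B φ₀ ψ₀ r) (mixState k) (mixState l)
      ≤ mkEDist A.lip k.1 l.1 + mkEDist B.lip k.2.1 l.2.1
        + ENNReal.ofReal (2 * r * |(k.2.2 : ℝ) - l.2.2|) := by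
  refine iSup₂_le fun d hd => ?_
  obtain ⟨h1, h2, -⟩ := (prodLip_le_one_iff φ₀ ψ₀ hr d).mp hd
  have e : (mixState k).1 (d : A × B) - (mixState l).1 (d : A × B)
      = ((k.2.2 : ℝ) : ℂ) * (k.1.1 (d : A × B).1 - l.1.1 (d : A × B).1)
        + ((1 - (k.2.2 : ℝ) : ℝ) : ℂ) * (k.2.1.1 (d : A × B).2 - l.2.1.1 (d : A × B).2)
        + (((k.2.2 : ℝ) - l.2.2 : ℝ) : ℂ) * (l.1.1 (d : A × B).1 - l.2.1.1 (d : A × B).2) := by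
    rw [mixState_apply, mixState_apply]
    push_cast
    ring
  have hs0 := k.2.2.2.1
  have hs1 := k.2.2.2.2
  -- Both values are compared with the same number φ₀(d.1), whence the constant 2r.
  have b1 := norm_state_sub_le φ₀ ψ₀ hr hA d hd (dualMap (StarAlgHom.fst ℂ A B) l.1)
  have b2 := norm_state_sub_le φ₀ ψ₀ hr hA d hd (dualMap (StarAlgHom.snd ℂ A B) l.2.1)
  have b3 : ‖l.1.1 (d : A × B).1 - l.2.1.1 (d : A × B).2‖ ≤ 2 * r := by
    have := norm_sub_le_of_le b1 b2
    rw [sub_sub_sub_cancel_right, ← two_mul] at this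
    exact this
  have main : ‖(mixState k).1 (d : A × B) - (mixState l).1 (d : A × B)‖
      ≤ ‖k.1.1 (d : A × B).1 - l.1.1 (d : A × B).1‖
        + ‖k.2.1.1 (d : A × B).2 - l.2.1.1 (d : A × B).2‖
        + 2 * r * |(k.2.2 : ℝ) - l.2.2| := by
    rw [e]
    refine norm_add₃_le.trans (add_le_add (add_le_add ?_ ?_) ?_)
    · rw [norm_mul, Complex.norm_real, Real.norm_of_nonneg hs0]
      exact mul_le_of_le_one_left (norm_nonneg _) hs1
    · rw [norm_mul, Complex.norm_real, Real.norm_of_nonneg (sub_nonneg.mpr hs1)]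
      exact mul_le_of_le_one_left (norm_nonneg _) (by linarith)
    · rw [norm_mul, Complex.norm_real, Real.norm_eq_abs, mul_comm]
      gcongr
  refine (ENNReal.ofReal_le_ofReal main).trans ?_
  rw [ENNReal.ofReal_add (by positivity) (by positivity),
    ENNReal.ofReal_add (by positivity) (by positivity)]
  gcongr
  · exact ofReal_norm_sub_le_mkEDist (L := A.lip) k.1 l.1 _ h1
  · exact ofReal_norm_sub_le_mkEDist (L := B.lip) k.2.1 l.2.1 _ h2

theorem continuous_mixState_mkSpace (hr : 0 < r)
    (hA : ∀ φ ψ, mkEDist A.lip φ ψ ≤ ENNReal.ofReal r) :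
    @Continuous _ (stateSpace (A × B)) _
      (mkSpace (prodLip A B φ₀ ψ₀ r)).toUniformSpace.toTopologicalSpace mixState := by
  let := mkSpace (prodLip A B φ₀ ψ₀ r)
  refine @continuous_iff_continuousAt _ _ _ (_) _ |>.mpr fun l => ?_
  refine tendsto_iff_edist_tendsto_0.mpr ?_
  refine tendsto_of_tendsto_of_tendsto_of_le_of_le tendsto_const_nhds ?_ (fun _ => zero_le)
    (fun k => mkEDist_mixState_le φ₀ ψ₀ hr hA k l)
  have t1 : Filter.Tendsto (fun k : stateSpace A × stateSpace B × I => mkEDist A.lip k.1 l.1)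
      (𝓝 l) (𝓝 0) := (A.tendsto_mkEDist l.1).comp (continuous_fst.tendsto l)
  have t2 : Filter.Tendsto (fun k : stateSpace A × stateSpace B × I => mkEDist B.lip k.2.1 l.2.1)
      (𝓝 l) (𝓝 0) :=
    (B.tendsto_mkEDist l.2.1).comp ((continuous_fst.comp continuous_snd).tendsto l)
  have t3 : Filter.Tendsto (fun k : stateSpace A × stateSpace B × I =>
      ENNReal.ofReal (2 * r * |(k.2.2 : ℝ) - l.2.2|)) (𝓝 l) (𝓝 0) := by
    have hc : Continuous fun k : stateSpace A × stateSpace B × I =>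
        ENNReal.ofReal (2 * r * |(k.2.2 : ℝ) - l.2.2|) :=
      ENNReal.continuous_ofReal.comp (by fun_prop)
    simpa using hc.tendsto l
  simpa using (t1.add t2).add t3

theorem IsLipschitzPair.t2Space {D : Type u} [CStarAlgebra D] {L : selfAdjoint D → ℝ≥0∞}
    (hL : IsLipschitzPair L) :
    @T2Space (stateSpace D) (mkSpace L).toUniformSpace.toTopologicalSpace := by
  let m : EMetricSpace (stateSpace D) :=
    { mkSpace L with eq_of_edist_eq_zero := hL.eq_of_mkEDist_eq_zero }
  infer_instance

/-- Finiteness follows by passing through the base state φ₀ ∘ π_A, and the topology by comparing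
both structures along `mixState`. -/
theorem prodLip_isQuantumCompactMetric (hr : 0 < r)
    (hA : ∀ φ ψ, mkEDist A.lip φ ψ ≤ ENNReal.ofReal r) :
    IsQuantumCompactMetric (prodLip A B φ₀ ψ₀ r) where
  toIsLipschitzPair := prodLip_isLipschitzPair A B φ₀ ψ₀ r hr
  mkEDist_ne_top φ ψ := by
    let m := mkSpace (prodLip A B φ₀ ψ₀ r)
    have h := m.edist_triangle φ (dualMap (StarAlgHom.fst ℂ A B) φ₀) ψ
    rw [m.edist_comm (dualMap (StarAlgHom.fst ℂ A B) φ₀) ψ] at h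
    exact ne_top_of_le_ne_top (ENNReal.add_ne_top.mpr ⟨ENNReal.ofReal_ne_top,
      ENNReal.ofReal_ne_top⟩) (h.trans (add_le_add (mkEDist_base_le φ₀ ψ₀ hr hA φ)
        (mkEDist_base_le φ₀ ψ₀ hr hA ψ)))
  metrizes :=
    topology_eq_of_continuous_surjective _ _ (prodLip_isLipschitzPair A B φ₀ ψ₀ r hr).t2Space
      inferInstance mixState_surjective (continuous_mixState_mkSpace φ₀ ψ₀ hr hA)
      continuous_mixState

/-- The product of two Leibniz quantum compact metric spaces with a coupling Lip-norm. -/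
noncomputable def prodQCMS (hr : 0 < r) (hA : ∀ φ ψ, mkEDist A.lip φ ψ ≤ ENNReal.ofReal r) :
    LeibnizQCMS.{u} where
  carrier := A × B
  lip := prodLip A B φ₀ ψ₀ r
  isQuantumCompactMetric := prodLip_isQuantumCompactMetric φ₀ ψ₀ hr hA
  isLeibniz := prodLip_isLeibniz A B φ₀ ψ₀ r hr
  lowerSemicontinuous := prodLip_lowerSemicontinuous A B φ₀ ψ₀ r

/-! ### Quotient seminorms, reach and depth of the tunnel -/

theorem ofReal_inv_mul_le {M x : ℝ} {l : ℝ≥0∞} (hM : 0 < M)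
    (h : ENNReal.ofReal x ≤ l * ENNReal.ofReal M) : ENNReal.ofReal (M⁻¹ * x) ≤ l := by
  rw [ENNReal.ofReal_mul (inv_nonneg.mpr hM.le), ENNReal.ofReal_inv_of_pos hM, mul_comm]
  exact ENNReal.div_le_of_le_mul h

/-- The scalar costs nothing in B, and the commutator is at most ‖a - φ₀(a)1‖ ≤ r L_A(a), because r
dominates the diameter of S(A). -/
theorem prodLip_pair_right_scalar_le (hr : 0 < r)
    (hA : ∀ φ ψ, mkEDist A.lip φ ψ ≤ ENNReal.ofReal r) (a : selfAdjoint A) (ha : A.lip a < ∞) :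
    prodLip A B φ₀ ψ₀ r (selfAdjointPair a ((φ₀.1 (a : A)).re • 1)) ≤ A.lip a := by
  refine max_le (max_le le_rfl ?_) (ofReal_inv_mul_le hr ((ENNReal.ofReal_le_ofReal ?_).trans
    (A.isQuantumCompactMetric.ofReal_norm_sub_smul_one_le hA φ₀ a ha)))
  · exact ((B.isQuantumCompactMetric.eq_zero_iff _).mpr ⟨_, rfl⟩).le.trans zero_le
  · exact pairCommutator_right_scalar_le A B φ₀ ψ₀ a ((φ₀.1 (a : A)).re : ℂ)

theorem prodLip_pair_left_scalar_le (hr : 0 < r)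
    (hB : ∀ φ ψ, mkEDist B.lip φ ψ ≤ ENNReal.ofReal r) (b : selfAdjoint B) (hb : B.lip b < ∞) :
    prodLip A B φ₀ ψ₀ r (selfAdjointPair ((ψ₀.1 (b : B)).re • 1) b) ≤ B.lip b := by
  refine max_le (max_le ?_ le_rfl) (ofReal_inv_mul_le hr ((ENNReal.ofReal_le_ofReal ?_).trans
    (B.isQuantumCompactMetric.ofReal_norm_sub_smul_one_le hB ψ₀ b hb)))
  · exact ((A.isQuantumCompactMetric.eq_zero_iff _).mpr ⟨_, rfl⟩).le.trans zero_le
  · exact pairCommutator_left_scalar_le A B φ₀ ψ₀ ((ψ₀.1 (b : B)).re : ℂ) b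

/-- The tunnel from `A` to `B` given by the coordinate projections of the product. -/
noncomputable def prodTunnel (hr : 0 < r) (hA : ∀ φ ψ, mkEDist A.lip φ ψ ≤ ENNReal.ofReal r)
    (hB : ∀ φ ψ, mkEDist B.lip φ ψ ≤ ENNReal.ofReal r) : Tunnel A B where
  space := prodQCMS φ₀ ψ₀ hr hA
  left := StarAlgHom.fst ℂ A B
  right := StarAlgHom.snd ℂ A B
  left_surjective a := ⟨(a, 0), rfl⟩
  right_surjective b := ⟨(0, b), rfl⟩
  left_quotient a := by
    refine le_antisymm (le_iInf₂ fun d hd => ?_) ?_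
    · obtain rfl : selfAdjointMap (StarAlgHom.fst ℂ A B) d = a := Subtype.ext hd
      exact lip_fst_le A B φ₀ ψ₀ r d
    · rcases eq_top_or_lt_top (A.lip a) with h | h
      · exact le_top.trans h.ge
      · exact iInf₂_le_of_le (selfAdjointPair a ((φ₀.1 (a : A)).re • 1)) rfl
          (prodLip_pair_right_scalar_le φ₀ ψ₀ hr hA a h)
  right_quotient b := by
    refine le_antisymm (le_iInf₂ fun d hd => ?_) ?_
    · obtain rfl : selfAdjointMap (StarAlgHom.snd ℂ A B) d = b := Subtype.ext hd
      exact lip_snd_le A B φ₀ ψ₀ r d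
    · rcases eq_top_or_lt_top (B.lip b) with h | h
      · exact le_top.trans h.ge
      · exact iInf₂_le_of_le (selfAdjointPair ((ψ₀.1 (b : B)).re • 1) b) rfl
          (prodLip_pair_left_scalar_le φ₀ ψ₀ hr hB b h)

theorem prodTunnel_reach_le (hr : 0 < r) (hA : ∀ φ ψ, mkEDist A.lip φ ψ ≤ ENNReal.ofReal r)
    (hB : ∀ φ ψ, mkEDist B.lip φ ψ ≤ ENNReal.ofReal r) :
    (prodTunnel φ₀ ψ₀ hr hA hB).reach ≤ ENNReal.ofReal r := by
  let := mkSpace (prodTunnel φ₀ ψ₀ hr hA hB).space.lip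
  refine Metric.hausdorffEDist_le_of_mem_edist ?_ ?_
  · rintro _ ⟨φ, rfl⟩
    exact ⟨_, ⟨ψ₀, rfl⟩, mkEDist_fst_snd_le φ₀ ψ₀ hr φ⟩
  · rintro _ ⟨ψ, rfl⟩
    exact ⟨_, ⟨φ₀, rfl⟩, mkEDist_base_le φ₀ ψ₀ hr hA _⟩

/-- The one point φ₀ ∘ π_A of the hull is already within r of every state. -/
theorem prodTunnel_depth_le (hr : 0 < r) (hA : ∀ φ ψ, mkEDist A.lip φ ψ ≤ ENNReal.ofReal r)
    (hB : ∀ φ ψ, mkEDist B.lip φ ψ ≤ ENNReal.ofReal r) :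
    (prodTunnel φ₀ ψ₀ hr hA hB).depth ≤ ENNReal.ofReal r := by
  let := mkSpace (prodTunnel φ₀ ψ₀ hr hA hB).space.lip
  refine Metric.hausdorffEDist_le_of_mem_edist (fun χ _ => ?_) fun χ _ => ?_
  · exact ⟨dualMap (prodTunnel φ₀ ψ₀ hr hA hB).left φ₀,
      subset_closedConvexHull (Set.mem_image_of_mem _ (Or.inl ⟨φ₀, rfl⟩)),
      mkEDist_base_le φ₀ ψ₀ hr hA χ⟩
  · exact ⟨χ, Set.mem_univ χ, (edist_self χ).le.trans zero_le⟩

end ProductSeminorm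

end QuantumMetric

theorem mainTheorem5 (A B : QuantumMetric.LeibnizQCMS.{u}) :
    QuantumMetric.dualPropinquity A B ≤ max A.stateDiam B.stateDiam := by
  -- Strict inequality keeps the scale positive even when both diameters vanish.
  refine le_of_forall_gt_imp_ge_of_dense fun M hM => ?_
  rcases eq_or_ne M ⊤ with rfl | hMtop
  · exact le_top
  have hr : 0 < M.toReal := ENNReal.toReal_pos hM.ne_bot hMtop
  have hMr : ENNReal.ofReal M.toReal = M := ENNReal.ofReal_toReal hMtop
  have hA : ∀ φ ψ, QuantumMetric.mkEDist A.lip φ ψ ≤ ENNReal.ofReal M.toReal := fun φ ψ =>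
    (QuantumMetric.mkEDist_le_stateDiam A φ ψ).trans
      ((le_max_left _ _).trans (hM.le.trans hMr.ge))
  have hB : ∀ φ ψ, QuantumMetric.mkEDist B.lip φ ψ ≤ ENNReal.ofReal M.toReal := fun φ ψ =>
    (QuantumMetric.mkEDist_le_stateDiam B φ ψ).trans
      ((le_max_right _ _).trans (hM.le.trans hMr.ge))
  let φ₀ : QuantumMetric.stateSpace A := Classical.arbitrary _
  let ψ₀ : QuantumMetric.stateSpace B := Classical.arbitrary _
  refine (iInf_le _ (.single (QuantumMetric.prodTunnel φ₀ ψ₀ hr hA hB))).trans ?_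
  exact (max_le (QuantumMetric.prodTunnel_reach_le φ₀ ψ₀ hr hA hB)
    (QuantumMetric.prodTunnel_depth_le φ₀ ψ₀ hr hA hB)).trans hMr.le
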